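/- Let $f:[0,1]\to\mathbb R$ be bounded, let $(x_i^{(n)})_{n\ge1,\,1\le i\le n}$ be a triangular array of design points in $[0,1]$, and let $\sigma>0$ be fixed and known. For each $n$ we observe $Y=F_0+\varepsilon$ with $F_0=(f(x_i^{(n)}))_{1\le i\le n}$ and $\varepsilon\sim N(0,\sigma^2 I_n)$; $\mathbb E$ denotes expectation under this true law. Fix an integer $q\ge1$ and a sequence of integers $k_n$ with $k_n\ge q$ for all large $n$. Let $(B_j)_{1\le j\le k_n}$ be the B-spline basis of the splines of order $q$ on the partition of $(0,1]$ into the $K=k_n+1-q$ intervals $((j-1)/K,j/K]$, let $\Phi=(B_j(x_i^{(n)}))_{i,j}$ be the $n\times k_n$ matrix of regressors, and suppose that there are constants $C_1,C_2>0$ such that, for all large $n$ and all $\theta\in\mathbb R^{k_n}$, $$C_1\frac{n}{k_n}\|\theta\|^2\le\theta^T\Phi^T\Phi\theta\le C_2\frac{n}{k_n}\|\theta\|^2 .$$ Put $\theta_Y=(\Phi^T\Phi)^{-1}\Phi^TY$ and $\theta_0=(\Phi^T\Phi)^{-1}\Phi^TF_0$. Let $\widetilde W(d\theta\mid Y)$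 be the posterior distribution of $\theta$ in the model $Y\sim N(\Phi\theta,\sigma^2I_n)$ under the prior $\theta\sim N(0,\tau_n^2I_{k_n})$. (1) If $\frac{k_n^2\ln n}{n}=o(\tau_n^2)$ and $\frac{k_n^3\ln n}{n}=o(\tau_n^4)$, then, as $n\to\infty$, $$\mathbb E\bigl\|\widetilde W(d\theta\mid Y)-N\bigl(\theta_Y,\sigma^2(\Phi^T\Phi)^{-1}\bigr)\bigr\|_{\mathrm{TV}}\to0,$$ and the convergence rate relative to the Euclidean norm for $\theta$ is $k_n/\sqrt n$: for every sequence $\lambda_n\to\infty$, $\mathbb E\bigl[\widetilde W\bigl(\|\theta-\theta_0\|\ge\lambda_n k_n/\sqrt n\mid Y\bigr)\bigr]\to0$. (2) In particular, if $\alpha>0$ and $k_n$ is of order exactly $n^{1/(1+2\alpha)}$ (bounded above and below by positive multiples of it for large $n$), then the two conditions on $\tau_n$ in (1) hold together if and only if $n^{(2-2\alpha)/(1+2\alpha)}\ln n=o(\tau_n^4)$, and under this condition the conclusion of (1) holds, the convergence rate for $\theta$ being $n^{(1-2\alpha)/(2(1+2\alpha))}$ (the Euclidean form, for the spline coefficients,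 of the minimax rate $n^{-\alpha/(1+2\alpha)}$); this includes the case $\alpha\le1$. -/

import Mathlib

open MeasureTheory ProbabilityTheory Filter Asymptotics Topology Matrix
open scoped ENNReal MatrixOrder

noncomputable section

namespace SplineRegression

/-! ### B-splines on `[0, 1]` -/

/-- The extended knot sequence (indexed from `0`) of the splines of order `q` on the partition of
`[0, 1]` into `K` intervals of equal length: `q` knots at `0`, then `1/K, …, (K-1)/K`, then knots
at `1`. Truncated subtraction gives the value `0` at the first `q` indices. -/
def knot (q K : ℕ) (i : ℕ) : ℝ := min 1 (((i + 1 - q : ℕ) : ℝ) / K)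

/-- The B-splines of degree `d` (order `d + 1`) of a nondecreasing knot sequence `t`, by the
Cox-de Boor recursion with the usual convention `0 / 0 = 0`. The basic intervals are
`(t j, t (j+1)]`, the first nondegenerate one being closed on the left as well, so that the
B-splines are also defined (by right continuity) at the leftmost knot. -/
def bsplineOfDegree (t : ℕ → ℝ) : ℕ → ℕ → ℝ → ℝ
  | 0, j, x =>
      open Classical in
      if t j < t (j + 1) ∧ (t j < x ∨ (x = t j ∧ t j = t 0)) ∧ x ≤ t (j + 1) then 1 else 0
  | d + 1, j, x =>
      (x - t j) / (t (j + d + 1) - t j) * bsplineOfDegree t d j x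
        + (t (j + d + 2) - x) / (t (j + d + 2) - t (j + 1)) * bsplineOfDegree t d (j + 1) x

/-- The `j`-th element (`j = 0, …, k - 1`) of the B-spline basis of the `k`-dimensional space of
splines of order `q` on the partition of `(0, 1]` into the `K = k + 1 - q` intervals
`((i - 1)/K, i/K]` (for `1 ≤ q ≤ k`). -/
def bspline (q k j : ℕ) (x : ℝ) : ℝ := bsplineOfDegree (knot q (k + 1 - q)) (q - 1) j x

/-- The matrix `Φ` of regressors `Φ i j = B_j (x_i)`. -/
def designMatrix (q k : ℕ) {n : ℕ} (x : Fin n → unitInterval) : Matrix (Fin n) (Fin k) ℝ :=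
  Matrix.of fun i j => bspline q k j (x i : ℝ)

/-! ### Gaussian linear regression -/

/-- The least squares coefficients `(Φᵀ Φ)⁻¹ Φᵀ y`. -/
def leastSquares {n k : ℕ} (Φ : Matrix (Fin n) (Fin k) ℝ) (y : EuclideanSpace ℝ (Fin n)) :
    EuclideanSpace ℝ (Fin k) :=
  WithLp.toLp 2 ((Φᵀ * Φ)⁻¹ *ᵥ (Φᵀ *ᵥ y.ofLp))

/-- The statistical model `θ ↦ N(Φ θ, v I_n)`, as a Markov kernel. -/
def model {n k : ℕ} (Φ : Matrix (Fin n) (Fin k) ℝ) (v : ℝ) :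
    Kernel (EuclideanSpace ℝ (Fin k)) (EuclideanSpace ℝ (Fin n)) where
  toFun θ := multivariateGaussian (WithLp.toLp 2 (Φ *ᵥ θ.ofLp)) (v • 1)
  measurable' := by
    unfold multivariateGaussian
    generalize toEuclideanCLM (𝕜 := ℝ) (CFC.sqrt (v • (1 : Matrix (Fin n) (Fin n) ℝ))) = T
    refine Measure.measurable_of_measurable_coe _ fun s hs => ?_
    have h1 : Continuous fun p : EuclideanSpace ℝ (Fin k) × EuclideanSpace ℝ (Fin n) =>
        WithLp.toLp 2 (Φ *ᵥ p.1.ofLp) :=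
      (PiLp.continuous_toLp 2 _).comp
        (Continuous.matrix_mulVec continuous_const
          ((PiLp.continuous_ofLp 2 _).comp continuous_fst))
    have hc : Continuous fun p : EuclideanSpace ℝ (Fin k) × EuclideanSpace ℝ (Fin n) =>
        WithLp.toLp 2 (Φ *ᵥ p.1.ofLp) + T p.2 := h1.add (by fun_prop)
    have h := measurable_measure_prodMk_left
      (ν := stdGaussian (EuclideanSpace ℝ (Fin n))) (hc.measurable hs)
    convert h using 2 with θ
    rw [Measure.map_apply (by fun_prop) hs]
    rfl

instance {n k : ℕ} (Φ : Matrix (Fin n) (Fin k) ℝ) (v : ℝ) : IsMarkovKernel (model Φ v) :=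
  ⟨fun θ => by
    change IsProbabilityMeasure (multivariateGaussian _ _)
    infer_instance⟩

/-- The posterior distribution `W̃(dθ | Y)` of the coefficients in the model
`Y ∼ N(Φ θ, σ² I_n)` under the prior `θ ∼ N(0, τ² I_k)`, as a kernel in the observation. -/
def posteriorDist {n k : ℕ} (Φ : Matrix (Fin n) (Fin k) ℝ) (σ τ : ℝ) :
    Kernel (EuclideanSpace ℝ (Fin n)) (EuclideanSpace ℝ (Fin k)) :=
  posterior (model Φ (σ ^ 2)) (multivariateGaussian 0 (τ ^ 2 • 1))

/-- The total variation distance `sup_A |P(A) - Q(A)|` of two probability measures. -/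
def tv {Ω : Type*} [MeasurableSpace Ω] (P Q : Measure Ω) : ℝ≥0∞ :=
  ⨆ (A : Set Ω) (_ : MeasurableSet A), ENNReal.ofReal |P.real A - Q.real A|

/-- The true mean vector `F₀ = (f (x_i))_i`. -/
def meanVec {n : ℕ} (f : unitInterval → ℝ) (x : Fin n → unitInterval) :
    EuclideanSpace ℝ (Fin n) :=
  WithLp.toLp 2 fun i => f (x i)

/-- The true distribution `N(F₀, σ² I_n)` of the observation. -/
def trueLaw {n : ℕ} (f : unitInterval → ℝ) (x : Fin n → unitInterval) (σ : ℝ) :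
    Measure (EuclideanSpace ℝ (Fin n)) :=
  multivariateGaussian (meanVec f x) (σ ^ 2 • 1)

/-- Asymptotic normality of the posterior in expected total variation:
`E ‖W̃(dθ | Y) - N(θ_Y, σ² (Φᵀ Φ)⁻¹)‖_TV → 0`, where `θ_Y = (Φᵀ Φ)⁻¹ Φᵀ Y`. -/
def BernsteinVonMises (f : unitInterval → ℝ) (x : ∀ n : ℕ, Fin n → unitInterval) (q : ℕ)
    (k : ℕ → ℕ) (σ : ℝ) (τ : ℕ → ℝ) : Prop :=
  Tendsto (fun n : ℕ =>
      ∫⁻ y, tv (posteriorDist (designMatrix q (k n) (x n)) σ (τ n) y)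
          (multivariateGaussian (leastSquares (designMatrix q (k n) (x n)) y)
            (σ ^ 2 • ((designMatrix q (k n) (x n))ᵀ * designMatrix q (k n) (x n))⁻¹))
        ∂(trueLaw f (x n) σ))
    atTop (𝓝 0)

/-- `r n` is a convergence rate, in Euclidean norm, of the posterior distribution of `θ` toward
`θ₀ = (Φᵀ Φ)⁻¹ Φᵀ F₀`: for every `L n → ∞`, `E [W̃(‖θ - θ₀‖ ≥ L n * r n | Y)] → 0`. -/
def ConvergenceRate (f : unitInterval → ℝ) (x : ∀ n : ℕ, Fin n → unitInterval) (q : ℕ)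
    (k : ℕ → ℕ) (σ : ℝ) (τ : ℕ → ℝ) (r : ℕ → ℝ) : Prop :=
  ∀ L : ℕ → ℝ, Tendsto L atTop atTop →
    Tendsto (fun n : ℕ =>
        ∫⁻ y, posteriorDist (designMatrix q (k n) (x n)) σ (τ n) y
            {θ | L n * r n ≤ ‖θ - leastSquares (designMatrix q (k n) (x n)) (meanVec f (x n))‖}
          ∂(trueLaw f (x n) σ))
      atTop (𝓝 0)

end SplineRegression

end

open SplineRegression

/-! The B-splines enter only through the lower bound `c = C₁ n / k` for the Gram matrix `G = Φᵀ Φ`, so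
the argument concerns Gaussian linear regression with an arbitrary design matrix.

By Bayes' formula and Pythagoras, the posterior is *exactly* the limiting Gaussian
`P = N(θ_Y, σ² G⁻¹)` with its density multiplied by `exp (-V)`, `V θ = ‖θ‖² / (2 τ²)`, and
renormalized (`posteriorDist_ae_eq_tilted`). This holds almost surely under the marginal law of the
Bayesian model, which dominates the true law. The Kullback-Leibler divergence of `P` from this tilting
is `∫ V dP + log ∫ exp (-V) dP`. With `m = θ_Y` and `S = σ² G⁻¹`, the bound `‖θ‖² ≥ 2 ⟪m, θ⟫ - ‖m‖²`
and the exponential moments of Gaussian linear functionals show that it is at most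
`tr S / (2 τ²) + mᵀ S m / (2 τ⁴)` (`tv_multivariateGaussian_tilted_le`). A linearized form of Pinsker's
inequality, `tv ≤ a + KL / a` for all `a > 0` (`tv_tilted_neg_le`), turns this into a bound on the total
variation distance that can be averaged over `Y`.

Since `S ≤ σ² k / (C₁ n)`, `‖θ₀‖² ≤ ‖F₀‖² / c` and `E ‖θ_Y - θ₀‖² = σ² tr G⁻¹`, the averaged divergence
is `O(k² / (n τ²) + k³ / (n τ⁴))` (`lintegral_tv_posteriorDist_le`), which tends to zero under the
two conditions on `τ`. The convergence rate follows from Markov's inequality for `P`, whose mean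
squared distance to `θ₀`, averaged over `Y`, is `2 σ² tr G⁻¹ = O(k² / n)`. The last part of the
statement compares powers of `n`. -/

namespace SplineRegression

/-! ### Exponential tilting and Gaussian densities -/

/-- Push-forward commutes with tilting. No invertibility of `e` is needed, because the tilting
function factors through `e`. -/
theorem map_tilted_comp {α β : Type*} [MeasurableSpace α] [MeasurableSpace β] (μ : Measure α)
    {e : α → β} (he : Measurable e) {f : β → ℝ} (hf : Measurable f) :
    (μ.tilted (fun x => f (e x))).map e = (μ.map e).tilted f := by
  ext s hs
  rw [Measure.map_apply he hs, tilted_apply' _ _ (he hs), tilted_apply' _ _ hs,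
    setLIntegral_map hs (by fun_prop) he, integral_map he.aemeasurable (by fun_prop)]

/-- Tilting renormalizes, so it does not see a constant factor of the measure; in this way Gaussian
normalizing constants and Jacobian determinants never have to be computed. -/
theorem smul_tilted {α : Type*} [MeasurableSpace α] (μ : Measure α) {c : ℝ≥0∞} (hc : c ≠ 0)
    (hc' : c ≠ ∞) (f : α → ℝ) : (c • μ).tilted f = μ.tilted f := by
  ext s hs
  rw [tilted_apply' _ _ hs, tilted_apply' _ _ hs, Measure.restrict_smul, lintegral_smul_measure,
    integral_smul_measure, smul_eq_mul, ← lintegral_const_mul' _ _ hc']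
  have hc0 : 0 < c.toReal := ENNReal.toReal_pos hc hc'
  refine lintegral_congr fun x => ?_
  conv_lhs => enter [1]; rw [← ENNReal.ofReal_toReal hc']
  rw [← ENNReal.ofReal_mul hc0.le, smul_eq_mul]
  congr 1
  by_cases h : ∫ x, Real.exp (f x) ∂μ = 0
  · simp [h]
  · field_simp

theorem tilted_add_const {α : Type*} [MeasurableSpace α] (μ : Measure α) (f : α → ℝ) (c : ℝ) :
    μ.tilted (fun x => f x + c) = μ.tilted f := by
  simp only [Measure.tilted, Real.exp_add, integral_mul_const]
  congr 1
  ext x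
  congr 1
  rw [mul_div_mul_right _ _ (Real.exp_pos c).ne']

theorem integrable_exp_of_tilted_ne_zero {α : Type*} [MeasurableSpace α] {μ : Measure α}
    {f : α → ℝ} (h : μ.tilted f ≠ 0) : Integrable (fun x => Real.exp (f x)) μ := by
  by_contra h'
  exact h (tilted_of_not_integrable h')

/-- The density of the standard Gaussian measure with respect to Lebesgue measure, up to its
normalizing constant. Both sides have the same characteristic function. -/
theorem stdGaussian_eq_tilted (E : Type*) [NormedAddCommGroup E] [InnerProductSpace ℝ E]
    [FiniteDimensional ℝ E] [MeasurableSpace E] [BorelSpace E] :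
    stdGaussian E = (volume : Measure E).tilted (fun x => -(‖x‖ ^ 2 / 2)) := by
  have hre : (0 : ℝ) < (1 / 2 : ℝ) := by norm_num
  have hZ := GaussianFourier.integral_rexp_neg_mul_sq_norm (V := E) hre
  have hint : Integrable (fun x : E => Real.exp (-(‖x‖ ^ 2 / 2))) := by
    by_contra h
    have : ∫ x : E, Real.exp (-(1 / 2) * ‖x‖ ^ 2) = 0 := by
      rw [← integral_undef h]; congr 1; ext x; ring_nf
    rw [this] at hZ
    have : (0 : ℝ) < (Real.pi / (1 / 2)) ^ (Module.finrank ℝ E / 2 : ℝ) := by positivity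
    linarith
  have := isProbabilityMeasure_tilted hint
  apply Measure.ext_of_charFun
  ext t
  have hZc := GaussianFourier.integral_cexp_neg_mul_sq_norm (V := E) (b := 1 / 2) (by norm_num)
  have hne : ((Real.pi : ℂ) / (1 / 2)) ^ (Module.finrank ℝ E / 2 : ℂ) ≠ 0 := by
    rw [Ne, Complex.cpow_eq_zero_iff]; simp [Real.pi_ne_zero]
  have h := GaussianFourier.integral_cexp_neg_mul_sq_norm_add (V := E) (b := 1 / 2) (by norm_num)
    Complex.I t
  rw [charFun_stdGaussian, charFun_apply, integral_tilted, eq_comm]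
  have hZ' : ((∫ x : E, Real.exp (-(‖x‖ ^ 2 / 2)) : ℝ) : ℂ) =
      (Real.pi / (1 / 2)) ^ (Module.finrank ℝ E / 2 : ℂ) := by
    rw [← hZc, ← integral_complex_ofReal]
    congr 1; ext x; push_cast; ring_nf
  simp_rw [Complex.real_smul, Complex.ofReal_div, hZ', div_mul_eq_mul_div]
  rw [integral_div, div_eq_iff hne]
  calc _ = ∫ v : E, Complex.exp (-(1 / 2) * ‖v‖ ^ 2 + Complex.I * inner ℝ t v) := by
        congr 1; ext x
        rw [Complex.ofReal_exp, ← Complex.exp_add, real_inner_comm]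
        push_cast; ring_nf
    _ = _ := by rw [h, mul_comm, Complex.I_sq]; ring_nf

theorem sq_norm_eq_dotProduct {ι : Type*} [Fintype ι] (x : EuclideanSpace ℝ ι) :
    ‖x‖ ^ 2 = x.ofLp ⬝ᵥ x.ofLp := by
  rw [EuclideanSpace.real_norm_sq_eq]
  simp [dotProduct, sq]

/-- The density of a nondegenerate Gaussian measure, up to its normalizing constant. -/
theorem multivariateGaussian_eq_tilted {ι : Type*} [Fintype ι] [DecidableEq ι]
    (m : EuclideanSpace ℝ ι) {S : Matrix ι ι ℝ} (hS : S.PosDef) :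
    multivariateGaussian m S = (volume : Measure (EuclideanSpace ℝ ι)).tilted
      (fun x => -((x - m).ofLp ⬝ᵥ (S⁻¹ *ᵥ (x - m).ofLp) / 2)) := by
  set R := CFC.sqrt S with hR
  have hRR : R * R = S := CFC.sqrt_mul_sqrt_self _ hS.posSemidef.nonneg
  have hRt : Rᵀ = R := by
    have := (CFC.sqrt_nonneg S).isSelfAdjoint.star_eq
    rwa [star_eq_conjTranspose, conjTranspose_eq_transpose_of_trivial] at this
  have hSu : IsUnit S.det := hS.det_pos.ne'.isUnit
  have hRu : IsUnit R.det := by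
    rw [← hRR, det_mul] at hSu
    exact isUnit_of_mul_isUnit_left hSu
  have hRS : R * (S⁻¹ * R) = 1 := by
    rw [← hRR, Matrix.mul_inv_rev, Matrix.mul_assoc, Matrix.nonsing_inv_mul _ hRu, Matrix.mul_one,
      Matrix.mul_nonsing_inv _ hRu]
  set T := toEuclideanCLM (𝕜 := ℝ) R
  have hT : ∀ x : EuclideanSpace ℝ ι, (T x).ofLp = R *ᵥ x.ofLp := fun x => rfl
  -- `x ↦ m + T x` carries Lebesgue measure to a positive multiple of itself, and the quadratic form
  -- of `S⁻¹` pulls back to the squared norm.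
  have hdet : LinearMap.det (T : EuclideanSpace ℝ ι →ₗ[ℝ] EuclideanSpace ℝ ι) ≠ 0 := by
    intro h0
    have hker := LinearMap.bot_lt_ker_of_det_eq_zero h0
    refine hker.ne' (LinearMap.ker_eq_bot'.2 fun x hx => ?_)
    have hx' : R *ᵥ x.ofLp = 0 := by
      rw [← hT]; exact congrArg WithLp.ofLp hx
    ext i
    rw [Matrix.eq_zero_of_mulVec_eq_zero hRu.ne_zero hx']
    rfl
  have hmap : (volume : Measure (EuclideanSpace ℝ ι)).map (fun x => m + T x)
      = ENNReal.ofReal |(LinearMap.det (T : EuclideanSpace ℝ ι →ₗ[ℝ] EuclideanSpace ℝ ι))⁻¹| •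
        volume := by
    rw [show (fun x => m + T x) = (fun x => m + x) ∘ T from rfl,
      ← Measure.map_map (by fun_prop) (by fun_prop)]
    have := Measure.map_linearMap_addHaar_eq_smul_addHaar volume hdet
    rw [ContinuousLinearMap.coe_coe] at this
    rw [this, Measure.map_smul, (measurePreserving_add_left volume m).map_eq]
  rw [multivariateGaussian, stdGaussian_eq_tilted, ← hR]
  have hf : (fun x : EuclideanSpace ℝ ι => -(‖x‖ ^ 2 / 2)) = fun x =>
      (fun x : EuclideanSpace ℝ ι => -((x - m).ofLp ⬝ᵥ (S⁻¹ *ᵥ (x - m).ofLp) / 2)) (m + T x) := by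
    ext x
    simp only [add_sub_cancel_left, hT]
    rw [mulVec_mulVec, dotProduct_mulVec, vecMul_mulVec, hRt, hRS, vecMul_one,
      sq_norm_eq_dotProduct]
  have hmeas : Measurable fun x : EuclideanSpace ℝ ι =>
      -((x - m).ofLp ⬝ᵥ (S⁻¹ *ᵥ (x - m).ofLp) / 2) := by
    simp only [dotProduct, mulVec]
    fun_prop
  have hm := map_tilted_comp volume (e := fun x => m + T x) (by fun_prop) hmeas
  rw [hf, hm, hmap, smul_tilted _ (by simpa using hdet) (by simp)]

/-! ### Bayes' formula -/

/-- Bayes' formula for a dominated model: if `κ θ` has density `d θ` with respect to `ν`, then the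
posterior has density `d θ y / ∫ d θ' y μ(dθ')` with respect to the prior `μ`. The kernel on the
right is the posterior because it disintegrates the joint law of `(Y, θ)`. -/
theorem posterior_eq_withDensity_div {Θ Y : Type*} [MeasurableSpace Θ] [MeasurableSpace Y]
    [StandardBorelSpace Θ] [Nonempty Θ] (μ : Measure Θ) [IsProbabilityMeasure μ]
    (ν : Measure Y) [SFinite ν] (κ : Kernel Θ Y) [IsMarkovKernel κ] {d : Θ → Y → ℝ≥0∞}
    (hd : Measurable (Function.uncurry d)) (hκ : ∀ θ, κ θ = ν.withDensity (d θ)) :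
    ∀ᵐ y ∂(κ ∘ₘ μ), (posterior κ μ) y
      = μ.withDensity (fun θ => d θ y / ∫⁻ θ', d θ' y ∂μ) := by
  set p : Y → ℝ≥0∞ := fun y => ∫⁻ θ', d θ' y ∂μ with hp
  have hpm : Measurable p := hd.lintegral_prod_left'
  have hmarg : κ ∘ₘ μ = ν.withDensity p := by
    ext s hs
    rw [Measure.bind_apply hs κ.aemeasurable, withDensity_apply _ hs]
    simp_rw [hκ, withDensity_apply _ hs]
    rw [lintegral_lintegral_swap hd.aemeasurable]
  have hpfin : ∫⁻ y, p y ∂ν = 1 := by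
    rw [← setLIntegral_univ, ← withDensity_apply _ .univ, ← hmarg, measure_univ]
  have hw : Measurable (Function.uncurry fun (y : Y) (θ : Θ) => d θ y / p y) :=
    (hd.comp measurable_swap).div (hpm.comp measurable_fst)
  set η : Kernel Y Θ := Kernel.withDensity (Kernel.const Y μ) (fun y θ => d θ y / p y) with hη
  have hηa : ∀ y, η y = μ.withDensity (fun θ => d θ y / p y) := fun y => by
    rw [hη, Kernel.withDensity_apply _ hw, Kernel.const_apply]
  have hfin : IsFiniteKernel η := by
    refine ⟨1, ENNReal.one_lt_top, fun y => ?_⟩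
    rw [hηa, withDensity_apply _ .univ, setLIntegral_univ]
    simp_rw [div_eq_mul_inv]
    have hdy : Measurable fun θ => d θ y := hd.comp measurable_prodMk_right
    rw [lintegral_mul_const _ hdy]
    exact ENNReal.mul_inv_le_one _
  have key : (κ ∘ₘ μ) ⊗ₘ η = (μ ⊗ₘ κ).map Prod.swap := by
    ext s hs
    have hs' : MeasurableSet (Prod.swap ⁻¹' s : Set (Θ × Y)) := measurable_swap hs
    have hind : Measurable fun z : Θ × Y => s.indicator (fun z => d z.2 z.1) z.swap :=
      ((hd.comp measurable_swap).indicator hs).comp measurable_swap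
    rw [Measure.map_apply measurable_swap hs, Measure.compProd_apply hs, Measure.compProd_apply hs',
      hmarg, lintegral_withDensity_eq_lintegral_mul _ hpm (Kernel.measurable_kernel_prodMk_left hs)]
    calc ∫⁻ y, (p * fun y => η y (Prod.mk y ⁻¹' s)) y ∂ν
        = ∫⁻ y, ∫⁻ θ, s.indicator (fun z => d z.2 z.1) (y, θ) ∂μ ∂ν := by
          refine lintegral_congr_ae ?_
          filter_upwards [ae_lt_top hpm (by rw [hpfin]; exact ENNReal.one_ne_top)] with y hy
          have hdy : Measurable fun θ => d θ y := hd.comp measurable_prodMk_right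
          rw [Pi.mul_apply, hηa, withDensity_apply _ (measurable_prodMk_left hs),
            ← lintegral_indicator (measurable_prodMk_left hs),
            ← lintegral_const_mul' _ _ hy.ne]
          refine lintegral_congr_ae ?_
          -- Where `p y = 0` the quotient `d θ y / p y` is junk, but `d θ y = 0` for `μ`-a.e. `θ`.
          by_cases h0 : p y = 0
          · filter_upwards [(lintegral_eq_zero_iff hdy).1 h0] with θ hθ
            have hθ' : d θ y = 0 := hθ
            simp [Set.indicator, hθ']
          · refine Eventually.of_forall fun θ => ?_
            by_cases hθ : (y, θ) ∈ s
            · simp [hθ, ENNReal.mul_div_cancel h0 hy.ne]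
            · simp [hθ]
      _ = ∫⁻ θ, ∫⁻ y, s.indicator (fun z => d z.2 z.1) (y, θ) ∂ν ∂μ :=
          (lintegral_lintegral_swap hind.aemeasurable).symm
      _ = ∫⁻ θ, κ θ (Prod.mk θ ⁻¹' (Prod.swap ⁻¹' s)) ∂μ := by
          refine lintegral_congr fun θ => ?_
          rw [hκ, withDensity_apply _ (measurable_prodMk_left hs'),
            ← lintegral_indicator (measurable_prodMk_left hs')]
          rfl
  filter_upwards [ae_eq_posterior_of_compProd_eq key] with y hy
  rw [← hy, hηa]

/-! ### Total variation between a measure and its tilting -/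

/-- The pointwise inequality behind a linearized form of Pinsker's inequality. With `r = √g` it
follows from `1 - g ≤ 2 (1 - r)`, `log r ≤ r - 1` and the arithmetic-geometric mean inequality. -/
theorem one_sub_le_add_sub_log_div {g a : ℝ} (hg : 0 < g) (ha : 0 < a) :
    1 - g ≤ a + (g - 1 - Real.log g) / a := by
  obtain ⟨r, hr, rfl⟩ : ∃ r : ℝ, 0 < r ∧ r ^ 2 = g := ⟨√g, Real.sqrt_pos.2 hg, Real.sq_sqrt hg.le⟩
  have hlog := Real.log_le_sub_one_of_pos hr
  have h1 : (1 - r) ^ 2 / a ≤ (r ^ 2 - 1 - Real.log (r ^ 2)) / a := by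
    gcongr
    rw [Real.log_pow]
    push_cast
    nlinarith
  have h2 : 2 * (1 - r) ≤ a + (1 - r) ^ 2 / a := by
    rw [← sub_nonneg, show a + (1 - r) ^ 2 / a - 2 * (1 - r) = (a - (1 - r)) ^ 2 / a by
      field_simp; ring]
    positivity
  nlinarith [sq_nonneg (1 - r)]

theorem tv_comm {Ω : Type*} [MeasurableSpace Ω] (P Q : Measure Ω) : tv P Q = tv Q P := by
  simp only [tv, abs_sub_comm]

/-- A one-sided bound suffices, since passing to complements changes the sign of `P A - Q A`. -/
theorem tv_le_of_forall_sub_le {Ω : Type*} [MeasurableSpace Ω] (P Q : Measure Ω)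
    [IsProbabilityMeasure P] [IsProbabilityMeasure Q] {b : ℝ}
    (h : ∀ A, MeasurableSet A → P.real A - Q.real A ≤ b) : tv P Q ≤ ENNReal.ofReal b := by
  refine iSup₂_le fun A hA => ENNReal.ofReal_le_ofReal (abs_le.2 ⟨?_, h A hA⟩)
  have := h Aᶜ hA.compl
  rw [probReal_compl_eq_one_sub hA, probReal_compl_eq_one_sub hA] at this
  linarith

/-- If the Kullback-Leibler divergence `∫ V dP + log ∫ exp (-V) dP` of `P` from its tilting is at
most `ε`, then their total variation distance is at most `a + ε / a`, for every `a > 0`. The bound is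
linear in `ε`, which makes it easy to average over random `ε`. -/
theorem tv_tilted_neg_le {Ω : Type*} [MeasurableSpace Ω] (P : Measure Ω) [IsProbabilityMeasure P]
    {V : Ω → ℝ} (hV : Integrable V P) (hexp : Integrable (fun ω => Real.exp (-V ω)) P) {ε a : ℝ}
    (ha : 0 < a) (hε : ∫ ω, Real.exp (-V ω) ∂P ≤ Real.exp (ε - ∫ ω, V ω ∂P)) :
    tv P (P.tilted fun ω => -V ω) ≤ ENNReal.ofReal (a + ε / a) := by
  have := isProbabilityMeasure_tilted hexp
  have hVn : Integrable (fun ω => -V ω) P := hV.neg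
  set Z := ∫ ω, Real.exp (-V ω) ∂P with hZ
  have hZ0 : 0 < Z := integral_exp_pos hexp
  -- `g` is the density of the tilted measure with respect to `P`.
  set g : Ω → ℝ := fun ω => Real.exp (-V ω) / Z with hg
  have hgi : Integrable g P := hexp.div_const Z
  have hlog : ∀ ω, Real.log (g ω) = -V ω - Real.log Z := fun ω => by
    rw [hg, Real.log_div (Real.exp_pos _).ne' hZ0.ne', Real.log_exp]
  have hlogi : Integrable (fun ω => Real.log (g ω)) P := by
    simp_rw [hlog]; exact hVn.sub (integrable_const _)
  have hg1 : ∫ ω, g ω ∂P = 1 := by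
    rw [hg, integral_div, div_self hZ0.ne']
  have hlogint : -∫ ω, Real.log (g ω) ∂P ≤ ε := by
    simp_rw [hlog]
    rw [integral_sub hVn (integrable_const _), integral_neg]
    have := Real.log_le_log hZ0 hε
    rw [Real.log_exp] at this
    simp
    linarith
  refine tv_le_of_forall_sub_le _ _ fun A hA => ?_
  have hQ : (P.tilted fun ω => -V ω).real A = ∫ ω in A, g ω ∂P := by
    rw [measureReal_def, tilted_apply_eq_ofReal_integral' _ hA, ENNReal.toReal_ofReal]
    exact setIntegral_nonneg hA fun ω _ => by positivity
  have hP : P.real A = ∫ ω in A, (1 : ℝ) ∂P := by simp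
  set b : Ω → ℝ := fun ω => a + (g ω - 1 - Real.log (g ω)) / a
  have hg1i : Integrable (fun ω => g ω - 1) P := hgi.sub (integrable_const 1)
  have hψi : Integrable (fun ω => g ω - 1 - Real.log (g ω)) P := hg1i.sub hlogi
  have hψa : Integrable (fun ω => (g ω - 1 - Real.log (g ω)) / a) P := hψi.div_const a
  have hb : Integrable b P := (integrable_const a).add hψa
  have hb0 : ∀ ω, 0 ≤ b ω := fun ω => by
    have := Real.log_le_sub_one_of_pos (show 0 < g ω by positivity)
    have : 0 ≤ g ω - 1 - Real.log (g ω) := by linarith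
    positivity
  calc P.real A - (P.tilted fun ω => -V ω).real A
      = ∫ ω in A, (1 - g ω) ∂P := by
        rw [hQ, hP, integral_sub (integrable_const _) hgi.integrableOn]
    _ ≤ ∫ ω in A, b ω ∂P := setIntegral_mono ((integrable_const _).sub hgi).integrableOn
        hb.integrableOn fun ω => one_sub_le_add_sub_log_div (by positivity) ha
    _ ≤ ∫ ω, b ω ∂P := setIntegral_le_integral hb (Eventually.of_forall hb0)
    _ = a + (∫ ω, g ω ∂P - 1 - ∫ ω, Real.log (g ω) ∂P) / a := by
        rw [integral_add (integrable_const _) hψa, integral_div, integral_sub hg1i hlogi,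
          integral_sub hgi (integrable_const 1)]
        simp
    _ ≤ _ := by
        rw [hg1]
        gcongr
        linarith

/-! ### The posterior as a tilting of the limiting Gaussian -/

/-- Bayes' formula when the model consists of tiltings of `ν` with the same normalizing constant
`Z`: the posterior is the prior tilted by the log-likelihood. The assumption `g ≤ 0` only serves to
make `exp (g · y)` integrable. -/
theorem posterior_ae_eq_tilted {Θ Y : Type*} [MeasurableSpace Θ] [MeasurableSpace Y]
    [StandardBorelSpace Θ] [Nonempty Θ] (μ : Measure Θ) [IsProbabilityMeasure μ]
    (ν : Measure Y) [SFinite ν] (κ : Kernel Θ Y) [IsMarkovKernel κ] {g : Θ → Y → ℝ}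
    (hg : Measurable (Function.uncurry g)) (hg0 : ∀ θ y, g θ y ≤ 0) {Z : ℝ}
    (hZ : ∀ θ, ∫ y, Real.exp (g θ y) ∂ν = Z) (hκ : ∀ θ, κ θ = ν.tilted (g θ)) :
    ∀ᵐ y ∂(κ ∘ₘ μ), (posterior κ μ) y = μ.tilted (fun θ => g θ y) := by
  obtain ⟨θ₀⟩ := ‹Nonempty Θ›
  have hZ0 : 0 < Z := by
    have h0 : 0 ≤ Z := by
      rw [← hZ θ₀]
      exact integral_nonneg fun y => (Real.exp_pos _).le
    refine lt_of_le_of_ne h0 fun h => ?_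
    have h1 : κ θ₀ = 0 := by
      rw [hκ, Measure.tilted, hZ, ← h]
      simp
    exact IsProbabilityMeasure.ne_zero (κ θ₀) h1
  have hd : Measurable (Function.uncurry fun θ y => ENNReal.ofReal (Real.exp (g θ y) / Z)) :=
    (hg.exp.div_const Z).ennreal_ofReal
  filter_upwards [posterior_eq_withDensity_div μ ν κ hd fun θ => by
    rw [hκ, Measure.tilted, hZ]] with y hy
  have hgy : Measurable fun θ => g θ y := hg.comp measurable_prodMk_right
  have hi : Integrable (fun θ => Real.exp (g θ y)) μ :=
    Integrable.of_bound hgy.exp.aestronglyMeasurable 1 (Eventually.of_forall fun θ => by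
      rw [Real.norm_eq_abs, abs_of_pos (Real.exp_pos _)]
      exact Real.exp_le_one_iff.2 (hg0 θ y))
  have hpos : 0 < ∫ θ, Real.exp (g θ y) ∂μ := integral_exp_pos hi
  have hp : ∫⁻ θ, ENNReal.ofReal (Real.exp (g θ y) / Z) ∂μ
      = ENNReal.ofReal ((∫ θ, Real.exp (g θ y) ∂μ) / Z) := by
    rw [← ofReal_integral_eq_lintegral_ofReal (hi.div_const Z)
      (Eventually.of_forall fun θ => by positivity), integral_div]
  rw [hy, Measure.tilted, hp]
  congr 1
  ext θ
  rw [← ENNReal.ofReal_div_of_pos (by positivity), div_div_div_cancel_right₀ hZ0.ne']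

theorem inv_smul_one_quadratic {ι : Type*} [Fintype ι] [DecidableEq ι] {v : ℝ} (hv : v ≠ 0)
    (x : EuclideanSpace ℝ ι) :
    x.ofLp ⬝ᵥ ((v • (1 : Matrix ι ι ℝ))⁻¹ *ᵥ x.ofLp) / 2 = ‖x‖ ^ 2 / (2 * v) := by
  have h : (v • (1 : Matrix ι ι ℝ))⁻¹ = v⁻¹ • 1 := by
    refine Matrix.inv_eq_left_inv ?_
    rw [smul_mul_smul_comm, inv_mul_cancel₀ hv, one_smul, Matrix.mul_one]
  rw [h, smul_mulVec, one_mulVec, dotProduct_smul, sq_norm_eq_dotProduct, smul_eq_mul]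
  field_simp

theorem posDef_smul_one (ι : Type*) [Fintype ι] [DecidableEq ι] {v : ℝ} (hv : 0 < v) :
    (v • (1 : Matrix ι ι ℝ)).PosDef := Matrix.PosDef.one.smul hv

theorem multivariateGaussian_smul_one_eq_tilted {ι : Type*} [Fintype ι] [DecidableEq ι]
    (m : EuclideanSpace ℝ ι) {v : ℝ} (hv : 0 < v) :
    multivariateGaussian m (v • 1) = (volume : Measure (EuclideanSpace ℝ ι)).tilted
      (fun x => -(‖x - m‖ ^ 2 / (2 * v))) := by
  rw [multivariateGaussian_eq_tilted m (posDef_smul_one ι hv)]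
  simp_rw [inv_smul_one_quadratic hv.ne']

/-- Pythagoras: the residual `y - Φ θ_Y` of least squares is orthogonal to the range of `Φ`. As a
function of `θ`, the log-likelihood is therefore that of `N(θ_Y, σ² (Φᵀ Φ)⁻¹)`, up to a constant. -/
theorem sq_norm_sub_mulVec {n k : ℕ} {Φ : Matrix (Fin n) (Fin k) ℝ} (hG : (Φᵀ * Φ).PosDef)
    (y : EuclideanSpace ℝ (Fin n)) (θ : EuclideanSpace ℝ (Fin k)) :
    ‖y - WithLp.toLp 2 (Φ *ᵥ θ.ofLp)‖ ^ 2 =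
      (θ - leastSquares Φ y).ofLp ⬝ᵥ ((Φᵀ * Φ) *ᵥ (θ - leastSquares Φ y).ofLp) +
        ‖y - WithLp.toLp 2 (Φ *ᵥ (leastSquares Φ y).ofLp)‖ ^ 2 := by
  set θY := leastSquares Φ y with hθY
  set u : Fin n → ℝ := y.ofLp - Φ *ᵥ θY.ofLp with hu
  set w : Fin k → ℝ := (θ - θY).ofLp with hw
  have horth : Φᵀ *ᵥ u = 0 := by
    rw [hu, mulVec_sub, mulVec_mulVec, hθY, leastSquares, mulVec_mulVec,
      Matrix.mul_nonsing_inv _ hG.det_pos.ne'.isUnit, one_mulVec, sub_self]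
  have h1 : (y - WithLp.toLp 2 (Φ *ᵥ θ.ofLp)).ofLp = u - Φ *ᵥ w := by
    simp [hu, hw, mulVec_sub]
  have h2 : (y - WithLp.toLp 2 (Φ *ᵥ θY.ofLp)).ofLp = u := by simp [hu]
  have h3 : u ⬝ᵥ (Φ *ᵥ w) = 0 := by
    rw [dotProduct_mulVec, ← mulVec_transpose, horth, zero_dotProduct]
  rw [sq_norm_eq_dotProduct, sq_norm_eq_dotProduct, h1, h2]
  clear_value u w
  rw [sub_dotProduct, dotProduct_sub,
    dotProduct_sub, h3, dotProduct_comm (Φ *ᵥ w) u, h3, dotProduct_mulVec (Φ *ᵥ w),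
    ← mulVec_transpose, mulVec_mulVec, dotProduct_comm w]
  ring

/-- The posterior is the limiting Gaussian `N(θ_Y, σ² (Φᵀ Φ)⁻¹)` tilted by the log-density of the
prior, for almost every observation under the marginal law of the Bayesian model. -/
theorem posteriorDist_ae_eq_tilted {n k : ℕ} {Φ : Matrix (Fin n) (Fin k) ℝ}
    (hG : (Φᵀ * Φ).PosDef) {σ τ : ℝ} (hσ : 0 < σ) (hτ : τ ≠ 0) :
    ∀ᵐ y ∂(model Φ (σ ^ 2) ∘ₘ multivariateGaussian 0 (τ ^ 2 • 1)), posteriorDist Φ σ τ y =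
      (multivariateGaussian (leastSquares Φ y) (σ ^ 2 • (Φᵀ * Φ)⁻¹)).tilted
        (fun θ => -(‖θ‖ ^ 2 / (2 * τ ^ 2))) := by
  have hσ2 : 0 < σ ^ 2 := by positivity
  have hτ2 : 0 < τ ^ 2 := by positivity
  have hS : (σ ^ 2 • (Φᵀ * Φ)⁻¹).PosDef := hG.inv.smul hσ2
  have hSinv : (σ ^ 2 • (Φᵀ * Φ)⁻¹)⁻¹ = (σ ^ 2)⁻¹ • (Φᵀ * Φ) := by
    refine Matrix.inv_eq_left_inv ?_
    rw [smul_mul_smul_comm, inv_mul_cancel₀ hσ2.ne', one_smul,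
      Matrix.mul_nonsing_inv _ hG.det_pos.ne'.isUnit]
  have hmul : Continuous fun θ : EuclideanSpace ℝ (Fin k) => WithLp.toLp 2 (Φ *ᵥ θ.ofLp) :=
    (PiLp.continuous_toLp 2 _).comp
      (Continuous.matrix_mulVec continuous_const (PiLp.continuous_ofLp 2 _))
  have hg : Measurable (Function.uncurry fun (θ : EuclideanSpace ℝ (Fin k))
      (y : EuclideanSpace ℝ (Fin n)) =>
        -(‖y - WithLp.toLp 2 (Φ *ᵥ θ.ofLp)‖ ^ 2 / (2 * σ ^ 2))) := by
    have := hmul.comp (continuous_fst (X := EuclideanSpace ℝ (Fin k))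
      (Y := EuclideanSpace ℝ (Fin n)))
    have h2 := (continuous_snd.sub this).norm
    exact (((h2.pow 2).div_const _).neg).measurable
  have hκ : ∀ θ : EuclideanSpace ℝ (Fin k), model Φ (σ ^ 2) θ = volume.tilted
      fun y => -(‖y - WithLp.toLp 2 (Φ *ᵥ θ.ofLp)‖ ^ 2 / (2 * σ ^ 2)) := fun θ =>
    multivariateGaussian_smul_one_eq_tilted _ hσ2
  filter_upwards [posterior_ae_eq_tilted (multivariateGaussian 0 (τ ^ 2 • 1)) volume
    (model Φ (σ ^ 2)) hg (fun θ y => neg_nonpos.2 (by positivity))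
    (fun θ => integral_sub_right_eq_self
      (fun y : EuclideanSpace ℝ (Fin n) => Real.exp (-(‖y‖ ^ 2 / (2 * σ ^ 2)))) _) hκ] with y hy
  have hprior := multivariateGaussian_smul_one_eq_tilted (0 : EuclideanSpace ℝ (Fin k)) hτ2
  have hpost := multivariateGaussian_eq_tilted (leastSquares Φ y) hS
  rw [posteriorDist, hy, hprior, hpost, tilted_tilted, tilted_tilted]
  · rw [← tilted_add_const _ (_ + fun θ => -(‖θ‖ ^ 2 / (2 * τ ^ 2)))
      (-(‖y - WithLp.toLp 2 (Φ *ᵥ (leastSquares Φ y).ofLp)‖ ^ 2 / (2 * σ ^ 2)))]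
    congr 1
    ext θ
    simp only [Pi.add_apply, sub_zero]
    rw [sq_norm_sub_mulVec hG y θ, hSinv, smul_mulVec, dotProduct_smul, smul_eq_mul]
    field_simp
    ring
  · exact integrable_exp_of_tilted_ne_zero (hpost ▸ IsProbabilityMeasure.ne_zero _)
  · exact integrable_exp_of_tilted_ne_zero (hprior ▸ IsProbabilityMeasure.ne_zero _)

/-- The true law of the observation is absolutely continuous with respect to the marginal law of the
Bayesian model, whatever the true mean `F`. Statements that hold marginal-almost everywhere therefore
hold almost surely under the true law. -/
theorem multivariateGaussian_absolutelyContinuous_marginal {n k : ℕ}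
    (Φ : Matrix (Fin n) (Fin k) ℝ) {v : ℝ} (hv : 0 < v) (μ : Measure (EuclideanSpace ℝ (Fin k)))
    [IsProbabilityMeasure μ] (F : EuclideanSpace ℝ (Fin n)) :
    multivariateGaussian F (v • 1) ≪ model Φ v ∘ₘ μ := by
  refine Measure.AbsolutelyContinuous.mk fun s hs h => ?_
  rw [Measure.bind_apply hs (model Φ v).aemeasurable,
    lintegral_eq_zero_iff ((model Φ v).measurable_coe hs)] at h
  obtain ⟨θ, hθ⟩ := h.exists
  have hθ' : model Φ v θ s = 0 := hθ
  have hm : model Φ v θ = multivariateGaussian (WithLp.toLp 2 (Φ *ᵥ θ.ofLp)) (v • 1) := rfl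
  have h1 := multivariateGaussian_smul_one_eq_tilted (WithLp.toLp 2 (Φ *ᵥ θ.ofLp)) hv
  have h2 : (volume : Measure (EuclideanSpace ℝ (Fin n))) ≪ model Φ v θ := by
    rw [hm, h1]
    exact absolutelyContinuous_tilted
      (integrable_exp_of_tilted_ne_zero (h1 ▸ IsProbabilityMeasure.ne_zero _))
  rw [multivariateGaussian_smul_one_eq_tilted F hv]
  exact (tilted_absolutelyContinuous _ _).trans h2 hθ'

/-! ### Gaussian moments and the effect of the prior -/

section GaussianMoments

variable {ι : Type*} [Fintype ι] [DecidableEq ι] (m : EuclideanSpace ℝ ι) {S : Matrix ι ι ℝ}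

theorem integral_inner_multivariateGaussian (a : EuclideanSpace ℝ ι) :
    ∫ x, inner ℝ a x ∂(multivariateGaussian m S) = inner ℝ a m := by
  have := (innerSL ℝ a).integral_comp_comm
    (IsGaussian.integrable_id (μ := multivariateGaussian m S))
  simpa using this

theorem variance_inner_multivariateGaussian (hS : S.PosSemidef) (a : EuclideanSpace ℝ ι) :
    Var[fun x => inner ℝ a x; multivariateGaussian m S] = a.ofLp ⬝ᵥ (S *ᵥ a.ofLp) := by
  rw [← covarianceBilin_multivariateGaussian hS (μ := m), covarianceBilin_self]
  exact IsGaussian.memLp_two_id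

theorem map_inner_multivariateGaussian (hS : S.PosSemidef) (a : EuclideanSpace ℝ ι) :
    (multivariateGaussian m S).map (fun x => inner ℝ a x)
      = gaussianReal (inner ℝ a m) (a.ofLp ⬝ᵥ (S *ᵥ a.ofLp)).toNNReal := by
  have h := IsGaussian.map_eq_gaussianReal (μ := multivariateGaussian m S) (innerSL ℝ a)
  simp only [innerSL_apply_apply] at h
  have hv := variance_inner_multivariateGaussian m hS a
  rw [← hv, ← integral_inner_multivariateGaussian m a (S := S)]
  exact h

theorem memLp_inner_sub_multivariateGaussian (a : EuclideanSpace ℝ ι) :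
    MemLp (fun x => inner ℝ a (x - m)) 2 (multivariateGaussian m S) := by
  have h : MemLp (fun x => x - m) 2 (multivariateGaussian m S) :=
    IsGaussian.memLp_two_id.sub (memLp_const m)
  exact (innerSL ℝ a).comp_memLp' h

theorem integral_inner_sub_sq_multivariateGaussian (hS : S.PosSemidef) (a : EuclideanSpace ℝ ι) :
    ∫ x, (inner ℝ a (x - m)) ^ 2 ∂(multivariateGaussian m S) = a.ofLp ⬝ᵥ (S *ᵥ a.ofLp) := by
  rw [← variance_inner_multivariateGaussian m hS a, variance_eq_integral (by fun_prop),
    integral_inner_multivariateGaussian]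
  simp_rw [inner_sub_right]

theorem integrable_norm_sub_sq_multivariateGaussian (b : EuclideanSpace ℝ ι) :
    Integrable (fun x => ‖x - b‖ ^ 2) (multivariateGaussian m S) := by
  have h : MemLp (fun x => x - b) 2 (multivariateGaussian m S) :=
    IsGaussian.memLp_two_id.sub (memLp_const b)
  exact h.integrable_norm_pow (by norm_num)

theorem integral_norm_sub_mean_sq_multivariateGaussian (hS : S.PosSemidef) :
    ∫ x, ‖x - m‖ ^ 2 ∂(multivariateGaussian m S) = S.trace := by
  have h : ∀ x : EuclideanSpace ℝ ι, ‖x - m‖ ^ 2 =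
      ∑ i, (inner ℝ (EuclideanSpace.single i (1 : ℝ)) (x - m)) ^ 2 := fun x => by
    rw [EuclideanSpace.real_norm_sq_eq]
    simp [EuclideanSpace.inner_single_left]
  simp_rw [h]
  rw [integral_finsetSum _ fun i _ => (memLp_inner_sub_multivariateGaussian m _).integrable_sq]
  simp_rw [integral_inner_sub_sq_multivariateGaussian m hS]
  simp [trace]

theorem integral_norm_sub_sq_multivariateGaussian (hS : S.PosSemidef) (b : EuclideanSpace ℝ ι) :
    ∫ x, ‖x - b‖ ^ 2 ∂(multivariateGaussian m S) = ‖m - b‖ ^ 2 + S.trace := by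
  have h : ∀ x : EuclideanSpace ℝ ι, ‖x - b‖ ^ 2 =
      ‖x - m‖ ^ 2 + 2 * inner ℝ (m - b) (x - m) + ‖m - b‖ ^ 2 := fun x => by
    rw [show x - b = (x - m) + (m - b) by abel, norm_add_sq_real, real_inner_comm]
  have h1 := integrable_norm_sub_sq_multivariateGaussian m (S := S) m
  have h2 : Integrable (fun x => 2 * inner ℝ (m - b) (x - m)) (multivariateGaussian m S) :=
    ((memLp_inner_sub_multivariateGaussian m (m - b)).integrable (by norm_num)).const_mul 2
  have h3 : ∫ x, inner ℝ (m - b) (x - m) ∂(multivariateGaussian m S) = 0 := by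
    simp_rw [inner_sub_right (m - b) _ m]
    rw [integral_sub _ (integrable_const _), integral_inner_multivariateGaussian]
    · simp
    · exact (innerSL ℝ (m - b)).integrable_comp IsGaussian.integrable_id
  rw [integral_congr_ae (Eventually.of_forall h)]
  have h12 : Integrable (fun x => ‖x - m‖ ^ 2 + 2 * inner ℝ (m - b) (x - m))
    (multivariateGaussian m S) := h1.add h2
  rw [integral_add h12 (integrable_const _), integral_add h1 h2, integral_const_mul, h3,
    integral_norm_sub_mean_sq_multivariateGaussian m hS]
  simp
  ring

/-- An upper bound for the Gaussian integral of `exp (-‖x‖² / (2 v))`. Dropping the square in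
`‖x‖² = ‖x - m‖² + 2 ⟪m, x⟫ - ‖m‖²` leaves the exponential moment of a linear functional. -/
theorem integral_exp_neg_norm_sq_multivariateGaussian_le (hS : S.PosSemidef) {v : ℝ} (hv : 0 < v) :
    ∫ x, Real.exp (-(‖x‖ ^ 2 / (2 * v))) ∂(multivariateGaussian m S) ≤
      Real.exp ((m.ofLp ⬝ᵥ (S *ᵥ m.ofLp)) / (2 * v ^ 2) - ‖m‖ ^ 2 / (2 * v)) := by
  have hm := mgf_gaussianReal (map_inner_multivariateGaussian m hS m) (-v⁻¹)
  have hnn : 0 ≤ m.ofLp ⬝ᵥ (S *ᵥ m.ofLp) := by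
    rw [← variance_inner_multivariateGaussian m hS]; exact variance_nonneg _ _
  have hint : Integrable (fun x => Real.exp (-v⁻¹ * inner ℝ m x)) (multivariateGaussian m S) := by
    by_contra h
    rw [mgf, integral_undef h] at hm
    exact (Real.exp_pos _).ne hm
  have hpt : ∀ x : EuclideanSpace ℝ ι, Real.exp (-(‖x‖ ^ 2 / (2 * v))) ≤
      Real.exp (‖m‖ ^ 2 / (2 * v)) * Real.exp (-v⁻¹ * inner ℝ m x) := fun x => by
    rw [← Real.exp_add, Real.exp_le_exp]
    have h1 : 0 ≤ ‖x - m‖ ^ 2 / (2 * v) := by positivity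
    rw [norm_sub_sq_real, real_inner_comm] at h1
    have h2 : (‖x‖ ^ 2 - 2 * inner ℝ m x + ‖m‖ ^ 2) / (2 * v) =
      ‖m‖ ^ 2 / (2 * v) + -v⁻¹ * inner ℝ m x + ‖x‖ ^ 2 / (2 * v) := by field_simp; ring
    linarith
  calc _ ≤ ∫ x, Real.exp (‖m‖ ^ 2 / (2 * v)) * Real.exp (-v⁻¹ * inner ℝ m x)
        ∂(multivariateGaussian m S) := integral_mono_of_nonneg
          (Eventually.of_forall fun x => (Real.exp_pos _).le) (hint.const_mul _)
          (Eventually.of_forall hpt)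
    _ = Real.exp (‖m‖ ^ 2 / (2 * v)) *
        Real.exp (inner ℝ m m * -v⁻¹ + (m.ofLp ⬝ᵥ (S *ᵥ m.ofLp)) * (-v⁻¹) ^ 2 / 2) := by
      rw [integral_const_mul]
      rw [mgf, Real.coe_toNNReal _ hnn] at hm
      rw [hm]
    _ = _ := by
      rw [← Real.exp_add, real_inner_self_eq_norm_sq]
      congr 1
      field_simp
      ring

/-- The total variation distance between a Gaussian measure and its tilting by a centred isotropic
Gaussian log-density of variance `v`. The bracket bounds their Kullback-Leibler divergence. -/
theorem tv_multivariateGaussian_tilted_le (hS : S.PosSemidef) {v a : ℝ} (hv : 0 < v) (ha : 0 < a) :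
    tv (multivariateGaussian m S)
        ((multivariateGaussian m S).tilted fun x => -(‖x‖ ^ 2 / (2 * v))) ≤
      ENNReal.ofReal (a +
        (S.trace / (2 * v) + (m.ofLp ⬝ᵥ (S *ᵥ m.ofLp)) / (2 * v ^ 2)) / a) := by
  have hi : Integrable (fun x => ‖x‖ ^ 2 / (2 * v)) (multivariateGaussian m S) := by
    simpa using (integrable_norm_sub_sq_multivariateGaussian m (S := S) 0).div_const (2 * v)
  have hV : ∫ x, ‖x‖ ^ 2 / (2 * v) ∂(multivariateGaussian m S)
      = (‖m‖ ^ 2 + S.trace) / (2 * v) := by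
    rw [integral_div]
    simpa using congrArg (· / (2 * v)) (integral_norm_sub_sq_multivariateGaussian m hS 0)
  refine tv_tilted_neg_le _ hi ?_ ha ?_
  · refine Integrable.of_bound (C := 1) (by fun_prop) (Eventually.of_forall fun x => ?_)
    rw [Real.norm_eq_abs, abs_of_pos (Real.exp_pos _)]
    exact Real.exp_le_one_iff.2 (neg_nonpos.2 (by positivity))
  · refine (integral_exp_neg_norm_sq_multivariateGaussian_le m hS hv).trans_eq ?_
    rw [hV]
    congr 1
    ring

end GaussianMoments

/-! ### Least squares with a coercive Gram matrix, and bounds at fixed sample size -/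

section CoerciveGram

variable {n k : ℕ} {Φ : Matrix (Fin n) (Fin k) ℝ} {c : ℝ}

theorem posDef_gram_of_coercive (hc : 0 < c)
    (h : ∀ θ : EuclideanSpace ℝ (Fin k), c * ‖θ‖ ^ 2 ≤ θ.ofLp ⬝ᵥ ((Φᵀ * Φ) *ᵥ θ.ofLp)) :
    (Φᵀ * Φ).PosDef := by
  refine Matrix.PosDef.of_dotProduct_mulVec_pos ?_ fun x hx => ?_
  · simpa using isHermitian_conjTranspose_mul_self Φ
  · have h1 := h (WithLp.toLp 2 x)
    have h2 : 0 < ‖WithLp.toLp 2 x‖ := norm_pos_iff.2 (by simpa using hx)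
    exact lt_of_lt_of_le (by positivity) h1

theorem quadratic_inv_gram_le (hc : 0 < c)
    (h : ∀ θ : EuclideanSpace ℝ (Fin k), c * ‖θ‖ ^ 2 ≤ θ.ofLp ⬝ᵥ ((Φᵀ * Φ) *ᵥ θ.ofLp))
    (a : EuclideanSpace ℝ (Fin k)) :
    a.ofLp ⬝ᵥ ((Φᵀ * Φ)⁻¹ *ᵥ a.ofLp) ≤ ‖a‖ ^ 2 / c := by
  have hG := posDef_gram_of_coercive hc h
  set b : EuclideanSpace ℝ (Fin k) := WithLp.toLp 2 ((Φᵀ * Φ)⁻¹ *ᵥ a.ofLp) with hb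
  have h1 := h b
  have h2 : (Φᵀ * Φ) *ᵥ b.ofLp = a.ofLp := by
    rw [hb, mulVec_mulVec, Matrix.mul_nonsing_inv _ hG.det_pos.ne'.isUnit, one_mulVec]
  have h3 : b.ofLp ⬝ᵥ a.ofLp = inner ℝ a b := by
    simp [PiLp.inner_apply, dotProduct]
  have h4 : a.ofLp ⬝ᵥ ((Φᵀ * Φ)⁻¹ *ᵥ a.ofLp) = inner ℝ a b := by
    rw [← h3, dotProduct_comm]
  rw [h2, h3] at h1
  have h5 := real_inner_le_norm a b
  rw [h4, le_div_iff₀ hc]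
  by_cases hb0 : ‖b‖ = 0
  · rw [hb0] at h5
    nlinarith [sq_nonneg ‖a‖]
  · have h6 : c * ‖b‖ ≤ ‖a‖ := by
      have : 0 < ‖b‖ := lt_of_le_of_ne (norm_nonneg b) (Ne.symm hb0)
      nlinarith
    nlinarith [norm_nonneg a, norm_nonneg b]

theorem trace_inv_gram_le (hc : 0 < c)
    (h : ∀ θ : EuclideanSpace ℝ (Fin k), c * ‖θ‖ ^ 2 ≤ θ.ofLp ⬝ᵥ ((Φᵀ * Φ) *ᵥ θ.ofLp)) :
    (Φᵀ * Φ)⁻¹.trace ≤ k / c := by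
  have h1 : ∀ i, (Φᵀ * Φ)⁻¹ i i ≤ 1 / c := fun i => by
    simpa using quadratic_inv_gram_le hc h (EuclideanSpace.single i (1 : ℝ))
  calc (Φᵀ * Φ)⁻¹.trace = ∑ i, (Φᵀ * Φ)⁻¹ i i := rfl
    _ ≤ ∑ _i : Fin k, 1 / c := Finset.sum_le_sum fun i _ => h1 i
    _ = k / c := by simp [div_eq_mul_inv]

/-- Least squares projects `y` onto the range of `Φ`, which does not increase the norm. -/
theorem norm_leastSquares_sq_le (hc : 0 < c)
    (h : ∀ θ : EuclideanSpace ℝ (Fin k), c * ‖θ‖ ^ 2 ≤ θ.ofLp ⬝ᵥ ((Φᵀ * Φ) *ᵥ θ.ofLp))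
    (y : EuclideanSpace ℝ (Fin n)) : ‖leastSquares Φ y‖ ^ 2 ≤ ‖y‖ ^ 2 / c := by
  have h1 := sq_norm_sub_mulVec (posDef_gram_of_coercive hc h) y 0
  have h2 := h (0 - leastSquares Φ y)
  rw [zero_sub, norm_neg] at h2
  have h3 : y - WithLp.toLp 2 (Φ *ᵥ (0 : EuclideanSpace ℝ (Fin k)).ofLp) = y := by simp
  rw [h3, zero_sub] at h1
  rw [le_div_iff₀ hc]
  nlinarith [sq_nonneg ‖y - WithLp.toLp 2 (Φ *ᵥ (leastSquares Φ y).ofLp)‖]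

theorem sq_norm_leastSquares_sub (y F : EuclideanSpace ℝ (Fin n)) :
    ‖leastSquares Φ y - leastSquares Φ F‖ ^ 2 =
      ∑ i, (inner ℝ (WithLp.toLp 2 (((Φᵀ * Φ)⁻¹ * Φᵀ) i) : EuclideanSpace ℝ (Fin n))
        (y - F)) ^ 2 := by
  rw [EuclideanSpace.real_norm_sq_eq]
  refine Finset.sum_congr rfl fun i _ => ?_
  congr 1
  simp only [leastSquares, mulVec_mulVec, PiLp.sub_apply, PiLp.inner_apply]
  rw [← Pi.sub_apply, ← mulVec_sub]
  simp [mulVec, dotProduct, mul_comm]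

theorem integrable_norm_leastSquares_sub_sq (F : EuclideanSpace ℝ (Fin n)) (v : ℝ) :
    Integrable (fun y => ‖leastSquares Φ y - leastSquares Φ F‖ ^ 2)
      (multivariateGaussian F (v • 1)) := by
  simp_rw [sq_norm_leastSquares_sub]
  exact integrable_finsetSum _ fun i _ =>
    (memLp_inner_sub_multivariateGaussian F _).integrable_sq

/-- The mean squared error of the least squares estimator is the trace of its covariance matrix
`v (Φᵀ Φ)⁻¹`. -/
theorem integral_norm_leastSquares_sub_sq (hG : (Φᵀ * Φ).PosDef)
    (F : EuclideanSpace ℝ (Fin n)) {v : ℝ} (hv : 0 < v) :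
    ∫ y, ‖leastSquares Φ y - leastSquares Φ F‖ ^ 2 ∂(multivariateGaussian F (v • 1))
      = v * (Φᵀ * Φ)⁻¹.trace := by
  have hAA : ((Φᵀ * Φ)⁻¹ * Φᵀ) * ((Φᵀ * Φ)⁻¹ * Φᵀ)ᵀ = (Φᵀ * Φ)⁻¹ := by
    have hGt : (Φᵀ * Φ)⁻¹ᵀ = (Φᵀ * Φ)⁻¹ := by
      rw [transpose_nonsing_inv, transpose_mul, transpose_transpose]
    rw [transpose_mul, transpose_transpose, hGt, Matrix.mul_assoc, ← Matrix.mul_assoc Φᵀ,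
      Matrix.mul_nonsing_inv _ hG.det_pos.ne'.isUnit, Matrix.mul_one]
  simp_rw [sq_norm_leastSquares_sub]
  rw [integral_finsetSum _ fun i _ => (memLp_inner_sub_multivariateGaussian F _).integrable_sq]
  simp_rw [integral_inner_sub_sq_multivariateGaussian F (posDef_smul_one _ hv).posSemidef]
  conv_rhs => rw [← hAA, trace, Finset.mul_sum]
  refine Finset.sum_congr rfl fun i _ => ?_
  rw [smul_mulVec, one_mulVec, dotProduct_smul]
  rfl

/-- The Bernstein-von Mises theorem at fixed sample size, under the lower bound `c` for the Gram
matrix. -/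
theorem lintegral_tv_posteriorDist_le (hc : 0 < c)
    (h : ∀ θ : EuclideanSpace ℝ (Fin k), c * ‖θ‖ ^ 2 ≤ θ.ofLp ⬝ᵥ ((Φᵀ * Φ) *ᵥ θ.ofLp))
    {σ τ a : ℝ} (hσ : 0 < σ) (hτ : τ ≠ 0) (ha : 0 < a) (F : EuclideanSpace ℝ (Fin n)) :
    ∫⁻ y, tv (posteriorDist Φ σ τ y)
        (multivariateGaussian (leastSquares Φ y) (σ ^ 2 • (Φᵀ * Φ)⁻¹))
        ∂(multivariateGaussian F (σ ^ 2 • 1)) ≤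
      ENNReal.ofReal (a + (σ ^ 2 * k / (2 * c * τ ^ 2) +
        σ ^ 2 / (c * τ ^ 4) * (‖F‖ ^ 2 / c + σ ^ 2 * k / c)) / a) := by
  have hG := posDef_gram_of_coercive hc h
  have hσ2 : 0 < σ ^ 2 := by positivity
  have hτ2 : 0 < τ ^ 2 := by positivity
  have hτ4 : 0 < τ ^ 4 := by positivity
  have hS : (σ ^ 2 • (Φᵀ * Φ)⁻¹).PosDef := hG.inv.smul hσ2
  set D : EuclideanSpace ℝ (Fin n) → ℝ := fun y => ‖leastSquares Φ y - leastSquares Φ F‖ ^ 2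
  have hDi : Integrable D (multivariateGaussian F (σ ^ 2 • 1)) :=
    integrable_norm_leastSquares_sub_sq F _
  have hDint : ∫ y, D y ∂(multivariateGaussian F (σ ^ 2 • 1)) ≤ σ ^ 2 * k / c := by
    rw [integral_norm_leastSquares_sub_sq hG F hσ2, mul_div_assoc]
    gcongr
    exact trace_inv_gram_le hc h
  set b : EuclideanSpace ℝ (Fin n) → ℝ := fun y => a + (σ ^ 2 * k / (2 * c * τ ^ 2) +
        σ ^ 2 / (c * τ ^ 4) * (‖F‖ ^ 2 / c + D y)) / a with hb
  have hbi1 : Integrable (fun y => ‖F‖ ^ 2 / c + D y) (multivariateGaussian F (σ ^ 2 • 1)) :=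
    (integrable_const _).add hDi
  have hbi2 : Integrable (fun y => (σ ^ 2 * k / (2 * c * τ ^ 2) +
        σ ^ 2 / (c * τ ^ 4) * (‖F‖ ^ 2 / c + D y)) / a) (multivariateGaussian F (σ ^ 2 • 1)) :=
    ((integrable_const _).add (hbi1.const_mul _)).div_const a
  have hbi : Integrable b (multivariateGaussian F (σ ^ 2 • 1)) := (integrable_const _).add hbi2
  have hb0 : ∀ y, 0 ≤ b y := fun y => by positivity
  calc _ ≤ ∫⁻ y, ENNReal.ofReal (b y) ∂(multivariateGaussian F (σ ^ 2 • 1)) := by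
        refine lintegral_mono_ae ?_
        filter_upwards [(multivariateGaussian_absolutelyContinuous_marginal Φ hσ2
          (multivariateGaussian 0 (τ ^ 2 • 1)) F).ae_le (posteriorDist_ae_eq_tilted hG hσ hτ)]
          with y hy
        rw [hy, tv_comm]
        refine (tv_multivariateGaussian_tilted_le (leastSquares Φ y) hS.posSemidef hτ2 ha).trans
          (ENNReal.ofReal_le_ofReal ?_)
        set m := leastSquares Φ y with hm
        have h1 := trace_inv_gram_le hc h
        have h2 := quadratic_inv_gram_le hc h m
        have h3 : ‖m‖ ^ 2 ≤ 2 * (‖F‖ ^ 2 / c + D y) := by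
          have h4 := norm_leastSquares_sq_le hc h F
          have h5 : ‖m‖ ≤ ‖m - leastSquares Φ F‖ + ‖leastSquares Φ F‖ :=
            norm_le_norm_sub_add m (leastSquares Φ F)
          have h6 : D y = ‖m - leastSquares Φ F‖ ^ 2 := rfl
          rw [h6]
          nlinarith [norm_nonneg m, sq_nonneg (‖m - leastSquares Φ F‖ - ‖leastSquares Φ F‖),
            norm_nonneg (m - leastSquares Φ F), norm_nonneg (leastSquares Φ F)]
        rw [trace_smul, smul_mulVec, dotProduct_smul, smul_eq_mul, smul_eq_mul]
        simp only [hb]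
        gcongr a + ?_ / a
        refine add_le_add ?_ ?_
        · calc σ ^ 2 * (Φᵀ * Φ)⁻¹.trace / (2 * τ ^ 2) ≤ σ ^ 2 * (k / c) / (2 * τ ^ 2) := by gcongr
            _ = _ := by field_simp
        · calc σ ^ 2 * (m.ofLp ⬝ᵥ ((Φᵀ * Φ)⁻¹ *ᵥ m.ofLp)) / (2 * (τ ^ 2) ^ 2)
              ≤ σ ^ 2 * (2 * (‖F‖ ^ 2 / c + D y) / c) / (2 * (τ ^ 2) ^ 2) := by
                gcongr
                exact h2.trans (by gcongr)
            _ = _ := by field_simp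
    _ = ENNReal.ofReal (∫ y, b y ∂(multivariateGaussian F (σ ^ 2 • 1))) :=
        (ofReal_integral_eq_lintegral_ofReal hbi (Eventually.of_forall hb0)).symm
    _ ≤ _ := by
        refine ENNReal.ofReal_le_ofReal ?_
        rw [hb, integral_add (integrable_const _) hbi2, integral_div,
          integral_add (integrable_const _) (hbi1.const_mul _), integral_const_mul,
          integral_add (integrable_const _) hDi]
        simp only [integral_const, probReal_univ, one_smul]
        gcongr

/-- Markov's inequality for the limiting Gaussian around the least squares coefficients of the true
mean, averaged over the observation. An arbitrary summand `g`, not assumed measurable, is carried along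
because the lower Lebesgue integral is subadditive only if one of the summands is measurable: it will
be a total variation distance. -/
theorem lintegral_add_gaussian_tail_le (hc : 0 < c)
    (h : ∀ θ : EuclideanSpace ℝ (Fin k), c * ‖θ‖ ^ 2 ≤ θ.ofLp ⬝ᵥ ((Φᵀ * Φ) *ᵥ θ.ofLp))
    {σ R : ℝ} (hσ : 0 < σ) (hR : 0 < R) (F : EuclideanSpace ℝ (Fin n))
    (g : EuclideanSpace ℝ (Fin n) → ℝ≥0∞) :
    ∫⁻ y, (g y + multivariateGaussian (leastSquares Φ y) (σ ^ 2 • (Φᵀ * Φ)⁻¹)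
        {θ | R ≤ ‖θ - leastSquares Φ F‖}) ∂(multivariateGaussian F (σ ^ 2 • 1)) ≤
      ∫⁻ y, g y ∂(multivariateGaussian F (σ ^ 2 • 1)) +
        ENNReal.ofReal (2 * (σ ^ 2 * k / c) / R ^ 2) := by
  have hG := posDef_gram_of_coercive hc h
  have hσ2 : 0 < σ ^ 2 := by positivity
  have hS : (σ ^ 2 • (Φᵀ * Φ)⁻¹).PosDef := hG.inv.smul hσ2
  have htr : σ ^ 2 * (Φᵀ * Φ)⁻¹.trace ≤ σ ^ 2 * k / c := by
    rw [mul_div_assoc]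
    gcongr
    exact trace_inv_gram_le hc h
  set D : EuclideanSpace ℝ (Fin n) → ℝ := fun y => ‖leastSquares Φ y - leastSquares Φ F‖ ^ 2
  have hDi : Integrable D (multivariateGaussian F (σ ^ 2 • 1)) :=
    integrable_norm_leastSquares_sub_sq F _
  have hDint : ∫ y, D y ∂(multivariateGaussian F (σ ^ 2 • 1)) ≤ σ ^ 2 * k / c :=
    (integral_norm_leastSquares_sub_sq hG F hσ2).trans_le htr
  have hbi : Integrable (fun y => (D y + σ ^ 2 * k / c) / R ^ 2)
      (multivariateGaussian F (σ ^ 2 • 1)) := (hDi.add (integrable_const _)).div_const _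
  calc _ ≤ ∫⁻ y, (g y + ENNReal.ofReal ((D y + σ ^ 2 * k / c) / R ^ 2))
        ∂(multivariateGaussian F (σ ^ 2 • 1)) := by
        refine lintegral_mono fun y => add_le_add le_rfl ?_
        have h1 := mul_meas_ge_le_integral_of_nonneg
          (μ := multivariateGaussian (leastSquares Φ y) (σ ^ 2 • (Φᵀ * Φ)⁻¹))
          (Eventually.of_forall fun θ => sq_nonneg ‖θ - leastSquares Φ F‖)
          (integrable_norm_sub_sq_multivariateGaussian (leastSquares Φ y) (leastSquares Φ F))
          (R ^ 2)
        rw [integral_norm_sub_sq_multivariateGaussian _ hS.posSemidef, trace_smul, smul_eq_mul]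
          at h1
        have h2 : {θ : EuclideanSpace ℝ (Fin k) | R ≤ ‖θ - leastSquares Φ F‖} =
            {θ | R ^ 2 ≤ ‖θ - leastSquares Φ F‖ ^ 2} := by
          ext θ
          exact (pow_le_pow_iff_left₀ hR.le (norm_nonneg _) two_ne_zero).symm
        rw [h2, ← ofReal_measureReal]
        refine ENNReal.ofReal_le_ofReal ?_
        rw [le_div_iff₀ (by positivity), mul_comm]
        exact h1.trans (add_le_add le_rfl htr)
    _ = ∫⁻ y, g y ∂(multivariateGaussian F (σ ^ 2 • 1)) +
        ENNReal.ofReal (∫ y, (D y + σ ^ 2 * k / c) / R ^ 2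
          ∂(multivariateGaussian F (σ ^ 2 • 1))) := by
        rw [lintegral_add_right' _ hbi.1.aemeasurable.ennreal_ofReal,
          ofReal_integral_eq_lintegral_ofReal hbi (Eventually.of_forall fun y => by positivity)]
    _ ≤ _ := by
        gcongr
        rw [integral_div, integral_add hDi (integrable_const _)]
        simp only [integral_const, probReal_univ, one_smul]
        gcongr
        linarith

end CoerciveGram

/-! ### Asymptotics -/

theorem norm_meanVec_sq_le {n : ℕ} {f : unitInterval → ℝ} {M : ℝ} (hM : ∀ u, |f u| ≤ M)
    (x : Fin n → unitInterval) : ‖meanVec f x‖ ^ 2 ≤ n * M ^ 2 := by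
  rw [EuclideanSpace.real_norm_sq_eq]
  calc ∑ i, (meanVec f x i) ^ 2 ≤ ∑ _i : Fin n, M ^ 2 :=
        Finset.sum_le_sum fun i _ => sq_le_sq' (abs_le.1 (hM (x i))).1 (abs_le.1 (hM (x i))).2
    _ = n * M ^ 2 := by simp

theorem measure_le_add_tv {Ω : Type*} [MeasurableSpace Ω] (P Q : Measure Ω) [IsFiniteMeasure P]
    [IsFiniteMeasure Q] {A : Set Ω} (hA : MeasurableSet A) : P A ≤ tv P Q + Q A := by
  have h : ENNReal.ofReal |P.real A - Q.real A| ≤ tv P Q :=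
    le_iSup₂ (f := fun (A : Set Ω) (_ : MeasurableSet A) => ENNReal.ofReal |P.real A - Q.real A|)
      A hA
  calc P A = ENNReal.ofReal (P.real A) := (ofReal_measureReal).symm
    _ ≤ ENNReal.ofReal (|P.real A - Q.real A| + Q.real A) :=
        ENNReal.ofReal_le_ofReal (by linarith [le_abs_self (P.real A - Q.real A)])
    _ = ENNReal.ofReal |P.real A - Q.real A| + Q A := by
        rw [ENNReal.ofReal_add (abs_nonneg _) measureReal_nonneg, ofReal_measureReal]
    _ ≤ _ := by gcongr

section Asymptotics

variable {f : unitInterval → ℝ} {x : ∀ n : ℕ, Fin n → unitInterval} {q : ℕ} {k : ℕ → ℕ}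
  {σ C : ℝ} {τ : ℕ → ℝ}

theorem bernsteinVonMises_of_isLittleO (hf : ∃ M : ℝ, ∀ u, |f u| ≤ M)
    (hk : ∀ᶠ n in atTop, 1 ≤ k n) (hσ : 0 < σ) (hC : 0 < C)
    (hdesign : ∀ᶠ n : ℕ in atTop, ∀ θ : EuclideanSpace ℝ (Fin (k n)),
      C * ((n : ℝ) / k n) * ‖θ‖ ^ 2 ≤
        θ.ofLp ⬝ᵥ (((designMatrix q (k n) (x n))ᵀ * designMatrix q (k n) (x n)) *ᵥ θ.ofLp))
    (h2 : (fun n : ℕ => (k n : ℝ) ^ 2 * Real.log n / n) =o[atTop] (fun n => τ n ^ 2))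
    (h4 : (fun n : ℕ => (k n : ℝ) ^ 3 * Real.log n / n) =o[atTop] (fun n => τ n ^ 4)) :
    BernsteinVonMises f x q k σ τ := by
  obtain ⟨M, hM⟩ := hf
  refine ENNReal.tendsto_nhds_zero.2 fun δ hδ => ?_
  obtain ⟨a, ha, haδ⟩ : ∃ a : ℝ, 0 < a ∧ ENNReal.ofReal (a + a) ≤ δ := by
    obtain ⟨b, hb, hbδ⟩ := ENNReal.lt_iff_exists_nnreal_btwn.1 hδ
    refine ⟨b / 2, by have : 0 < b := by exact_mod_cast hb
                      positivity, ?_⟩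
    rw [add_halves, ENNReal.ofReal_coe_nnreal]
    exact hbδ.le
  set A := σ ^ 2 / (2 * C) with hA
  set B := σ ^ 2 * M ^ 2 / C ^ 2 + σ ^ 4 / C ^ 2 with hB
  have hlim : Tendsto (fun n : ℕ => A * ((k n : ℝ) ^ 2 * Real.log n / n / τ n ^ 2) +
      B * ((k n : ℝ) ^ 3 * Real.log n / n / τ n ^ 4)) atTop (𝓝 0) := by
    simpa using (h2.tendsto_div_nhds_zero.const_mul A).add (h4.tendsto_div_nhds_zero.const_mul B)
  have hlog : ∀ᶠ n : ℕ in atTop, 1 ≤ Real.log n :=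
    (Real.tendsto_log_atTop.comp tendsto_natCast_atTop_atTop).eventually_ge_atTop 1
  filter_upwards [hk, hdesign, hlog, eventually_ge_atTop 1,
    hlim.eventually_lt_const (show (0 : ℝ) < a * a by positivity),
    h2.bound one_pos] with n hkn hdn hlogn hn hlt hbd
  have hk0 : (0 : ℝ) < k n := by exact_mod_cast hkn
  have hn0 : (1 : ℝ) ≤ n := by exact_mod_cast hn
  have hn1 : (0 : ℝ) < n := by linarith
  -- For `τ n = 0` the prior would be degenerate; the first condition excludes this for large `n`.
  have hτ : τ n ≠ 0 := by
    rintro h0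
    rw [h0] at hbd
    simp only [Real.norm_eq_abs] at hbd
    have h3 : 0 < (k n : ℝ) ^ 2 * Real.log n / n := by positivity
    rw [abs_of_pos h3] at hbd
    norm_num at hbd
    linarith
  have hτ2 : 0 < τ n ^ 2 := by positivity
  have hτ4 : 0 < τ n ^ 4 := by positivity
  have hc : 0 < C * ((n : ℝ) / k n) := by positivity
  -- With `c = C n / k`, the three terms of the bound are of orders `k² / (n τ²)`, `k² / (n τ⁴)` and
  -- `k³ / (n² τ⁴)`.
  refine (lintegral_tv_posteriorDist_le hc hdn hσ hτ ha (meanVec f (x n))).trans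
    (le_trans (ENNReal.ofReal_le_ofReal ?_) haδ)
  rw [add_le_add_iff_left, div_le_iff₀ ha]
  refine le_trans ?_ hlt.le
  refine add_le_add ?_ ?_
  · calc σ ^ 2 * k n / (2 * (C * (n / k n)) * τ n ^ 2)
        = A * ((k n : ℝ) ^ 2 * 1 / n / τ n ^ 2) := by rw [hA]; field_simp
      _ ≤ _ := by gcongr
  · calc σ ^ 2 / (C * (n / k n) * τ n ^ 4) *
          (‖meanVec f (x n)‖ ^ 2 / (C * (n / k n)) + σ ^ 2 * k n / (C * (n / k n)))
        ≤ σ ^ 2 / (C * (n / k n) * τ n ^ 4) *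
          (n * M ^ 2 / (C * (n / k n)) + σ ^ 2 * k n / (C * (n / k n))) := by
          gcongr
          exact norm_meanVec_sq_le hM (x n)
      _ = σ ^ 2 * M ^ 2 / C ^ 2 * ((k n : ℝ) ^ 2 * 1 / n / τ n ^ 4) +
          σ ^ 4 / C ^ 2 * ((k n : ℝ) ^ 3 * 1 / n / τ n ^ 4) * (1 / n) := by
          field_simp
      _ ≤ σ ^ 2 * M ^ 2 / C ^ 2 * ((k n : ℝ) ^ 3 * Real.log n / n / τ n ^ 4) +
          σ ^ 4 / C ^ 2 * ((k n : ℝ) ^ 3 * Real.log n / n / τ n ^ 4) * 1 := by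
          gcongr
          · exact_mod_cast hkn
          · norm_num
          · exact div_le_one_of_le₀ hn0 hn1.le
      _ = _ := by rw [hB]; ring

/-- Up to the total variation error, the posterior mass outside a ball is that of the limiting
Gaussian, whose mean squared distance to `θ₀`, averaged over `Y`, is of order `k² / n`. -/
theorem convergenceRate_of_bernsteinVonMises
    (hk : ∀ᶠ n in atTop, 1 ≤ k n) (hσ : 0 < σ) (hC : 0 < C)
    (hdesign : ∀ᶠ n : ℕ in atTop, ∀ θ : EuclideanSpace ℝ (Fin (k n)),
      C * ((n : ℝ) / k n) * ‖θ‖ ^ 2 ≤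
        θ.ofLp ⬝ᵥ (((designMatrix q (k n) (x n))ᵀ * designMatrix q (k n) (x n)) *ᵥ θ.ofLp))
    (h : BernsteinVonMises f x q k σ τ) :
    ConvergenceRate f x q k σ τ (fun n => (k n : ℝ) / Real.sqrt n) := by
  intro L hL
  have hlim : Tendsto (fun n => ENNReal.ofReal (2 * σ ^ 2 / C / L n ^ 2)) atTop (𝓝 0) := by
    rw [← ENNReal.ofReal_zero]
    exact ENNReal.tendsto_ofReal
      (tendsto_const_nhds.div_atTop ((tendsto_pow_atTop two_ne_zero).comp hL))
  have hsum := h.add hlim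
  rw [add_zero] at hsum
  refine tendsto_of_tendsto_of_tendsto_of_le_of_le' tendsto_const_nhds hsum
    (Eventually.of_forall fun _ => zero_le) ?_
  filter_upwards [hk, hdesign, eventually_ge_atTop 1, hL.eventually_gt_atTop 0]
    with n hkn hdn hn hLn
  have hk0 : (0 : ℝ) < k n := by exact_mod_cast hkn
  have hn1 : (0 : ℝ) < n := by exact_mod_cast hn
  have hc : 0 < C * ((n : ℝ) / k n) := by positivity
  have hR : 0 < L n * ((k n : ℝ) / Real.sqrt n) := by positivity
  set B : Set (EuclideanSpace ℝ (Fin (k n))) := {θ | L n * ((k n : ℝ) / Real.sqrt n) ≤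
    ‖θ - leastSquares (designMatrix q (k n) (x n)) (meanVec f (x n))‖} with hB
  have hBm : MeasurableSet B := measurableSet_le measurable_const (by fun_prop)
  have hpost : ∀ y, IsProbabilityMeasure
      (posteriorDist (designMatrix q (k n) (x n)) σ (τ n) y) := fun y => by
    unfold posteriorDist; infer_instance
  refine (lintegral_mono fun y => measure_le_add_tv _ (multivariateGaussian
    (leastSquares (designMatrix q (k n) (x n)) y)
    (σ ^ 2 • ((designMatrix q (k n) (x n))ᵀ * designMatrix q (k n) (x n))⁻¹)) hBm).trans ?_
  refine (lintegral_add_gaussian_tail_le hc hdn hσ hR (meanVec f (x n)) _).trans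
    (add_le_add le_rfl (ENNReal.ofReal_le_ofReal (le_of_eq ?_)))
  rw [mul_pow, div_pow, Real.sq_sqrt hn1.le]
  field_simp

/-- A constant factor in the rate is absorbed by the sequence `L → ∞`. -/
theorem convergenceRate_mono {r r' : ℕ → ℝ} (h : ConvergenceRate f x q k σ τ r) {c : ℝ}
    (hc : 0 < c) (hr : ∀ᶠ n in atTop, c * r n ≤ r' n) : ConvergenceRate f x q k σ τ r' := by
  intro L hL
  refine tendsto_of_tendsto_of_tendsto_of_le_of_le' tendsto_const_nhds
    (h (fun n => L n * c) (hL.atTop_mul_const hc)) (Eventually.of_forall fun _ => zero_le) ?_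
  filter_upwards [hr, hL.eventually_ge_atTop 0] with n hn hLn
  refine lintegral_mono fun y => measure_mono fun θ hθ => ?_
  rw [Set.mem_ofPred_eq] at hθ ⊢
  refine le_trans ?_ hθ
  rw [mul_assoc]
  exact mul_le_mul_of_nonneg_left hn hLn

end Asymptotics

/-! ### The regime `k n ≍ n ^ (1 / (1 + 2 α))` -/

section PowerRegime

variable {k : ℕ → ℕ} {α : ℝ}

theorem pow_mul_log_div_isTheta (hα : 0 < α)
    (hk : (fun n : ℕ => (k n : ℝ)) =Θ[atTop] (fun n : ℕ => (n : ℝ) ^ (1 / (1 + 2 * α)))) (p : ℕ) :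
    (fun n : ℕ => (k n : ℝ) ^ p * Real.log n / n) =Θ[atTop]
      (fun n : ℕ => (n : ℝ) ^ ((p - 1 - 2 * α) / (1 + 2 * α)) * Real.log n) := by
  have h := ((hk.pow p).mul (isTheta_refl (fun n : ℕ => Real.log n) atTop)).div
    (isTheta_refl (fun n : ℕ => (n : ℝ)) atTop)
  refine h.trans_eventuallyEq ?_
  filter_upwards [eventually_gt_atTop 0] with n hn
  have hn0 : (0 : ℝ) < n := by exact_mod_cast hn
  rw [← Real.rpow_natCast, ← Real.rpow_mul hn0.le, mul_div_right_comm, ← Real.rpow_sub_one hn0.ne']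
  congr 2
  field_simp
  ring

/-- In the power regime the condition on `τ ^ 4` implies the one on `τ ^ 2`: after squaring, the
latter asks for an extra factor `n ^ (-2 α / (1 + 2 α)) * log n`, which tends to zero. -/
theorem conditions_iff_of_isTheta (hα : 0 < α)
    (hk : (fun n : ℕ => (k n : ℝ)) =Θ[atTop] (fun n : ℕ => (n : ℝ) ^ (1 / (1 + 2 * α))))
    (τ : ℕ → ℝ) :
    (((fun n : ℕ => (k n : ℝ) ^ 2 * Real.log n / n) =o[atTop] (fun n => τ n ^ 2)) ∧
        ((fun n : ℕ => (k n : ℝ) ^ 3 * Real.log n / n) =o[atTop] (fun n => τ n ^ 4))) ↔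
      (fun n : ℕ => (n : ℝ) ^ ((2 - 2 * α) / (1 + 2 * α)) * Real.log n)
        =o[atTop] (fun n => τ n ^ 4) := by
  have h3 := pow_mul_log_div_isTheta hα hk 3
  have h2 := pow_mul_log_div_isTheta hα hk 2
  have e3 : (((3 : ℕ) : ℝ) - 1 - 2 * α) = 2 - 2 * α := by push_cast; ring
  have e2 : (((2 : ℕ) : ℝ) - 1 - 2 * α) = 1 - 2 * α := by push_cast; ring
  rw [e3] at h3
  rw [e2] at h2
  rw [h3.isLittleO_congr_left, h2.isLittleO_congr_left, and_iff_right_iff_imp]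
  intro h
  have hlog : (fun n : ℕ => Real.log n) =o[atTop] (fun n : ℕ => (n : ℝ) ^ (2 * α / (1 + 2 * α))) :=
    (isLittleO_log_rpow_atTop (by positivity)).comp_tendsto tendsto_natCast_atTop_atTop
  have hsq : (fun n : ℕ => ((n : ℝ) ^ ((1 - 2 * α) / (1 + 2 * α)) * Real.log n) ^ 2) =o[atTop]
      fun n => (τ n ^ 2) ^ 2 := by
    have h5 : (fun n : ℕ => ((n : ℝ) ^ ((1 - 2 * α) / (1 + 2 * α))) ^ 2 * Real.log n * Real.log n)
        =O[atTop] (fun n : ℕ => ((n : ℝ) ^ ((1 - 2 * α) / (1 + 2 * α))) ^ 2 * Real.log n *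
          (n : ℝ) ^ (2 * α / (1 + 2 * α))) := (isBigO_refl _ _).mul hlog.isBigO
    refine (h5.congr' ?_ ?_).trans_isLittleO (h.congr_right fun n => by ring)
    · exact Eventually.of_forall fun n => by ring
    · filter_upwards [eventually_gt_atTop 0] with n hn
      have hn0 : (0 : ℝ) < n := by exact_mod_cast hn
      rw [← Real.rpow_natCast, ← Real.rpow_mul hn0.le, mul_right_comm, ← Real.rpow_add hn0]
      congr 2
      field_simp
      push_cast
      ring
  exact hsq.of_pow two_ne_zero

theorem rate_isTheta (hα : 0 < α)
    (hk : (fun n : ℕ => (k n : ℝ)) =Θ[atTop] (fun n : ℕ => (n : ℝ) ^ (1 / (1 + 2 * α)))) :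
    (fun n : ℕ => (k n : ℝ) / Real.sqrt n) =Θ[atTop]
      (fun n : ℕ => (n : ℝ) ^ ((1 - 2 * α) / (2 * (1 + 2 * α)))) := by
  refine (hk.div (isTheta_refl (fun n : ℕ => Real.sqrt n) atTop)).trans_eventuallyEq ?_
  filter_upwards [eventually_gt_atTop 0] with n hn
  have hn0 : (0 : ℝ) < n := by exact_mod_cast hn
  rw [Real.sqrt_eq_rpow, ← Real.rpow_sub hn0]
  congr 1
  field_simp
  ring

end PowerRegime

end SplineRegression

theorem proposition8
    (f : unitInterval → ℝ) (hf : ∃ M : ℝ, ∀ u, |f u| ≤ M)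
    (x : ∀ n : ℕ, Fin n → unitInterval)
    (q : ℕ) (hq : 1 ≤ q) (k : ℕ → ℕ) (hk : ∀ᶠ n in atTop, q ≤ k n)
    (σ : ℝ) (hσ : 0 < σ)
    (C₁ C₂ : ℝ) (hC₁ : 0 < C₁) (hC₂ : 0 < C₂)
    (hdesign : ∀ᶠ n : ℕ in atTop, ∀ θ : EuclideanSpace ℝ (Fin (k n)),
      C₁ * ((n : ℝ) / k n) * ‖θ‖ ^ 2 ≤
          θ.ofLp ⬝ᵥ (((designMatrix q (k n) (x n))ᵀ * designMatrix q (k n) (x n)) *ᵥ θ.ofLp) ∧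
        θ.ofLp ⬝ᵥ (((designMatrix q (k n) (x n))ᵀ * designMatrix q (k n) (x n)) *ᵥ θ.ofLp) ≤
          C₂ * ((n : ℝ) / k n) * ‖θ‖ ^ 2)
    (τ : ℕ → ℝ) :
    ((fun n : ℕ => (k n : ℝ) ^ 2 * Real.log n / n) =o[atTop] (fun n => τ n ^ 2) →
      (fun n : ℕ => (k n : ℝ) ^ 3 * Real.log n / n) =o[atTop] (fun n => τ n ^ 4) →
        BernsteinVonMises f x q k σ τ ∧
        ConvergenceRate f x q k σ τ (fun n => (k n : ℝ) / Real.sqrt n)) ∧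
    (∀ α : ℝ, 0 < α →
      (fun n : ℕ => (k n : ℝ)) =Θ[atTop] (fun n : ℕ => (n : ℝ) ^ (1 / (1 + 2 * α))) →
        ((((fun n : ℕ => (k n : ℝ) ^ 2 * Real.log n / n) =o[atTop] (fun n => τ n ^ 2)) ∧
            ((fun n : ℕ => (k n : ℝ) ^ 3 * Real.log n / n) =o[atTop] (fun n => τ n ^ 4))) ↔
          (fun n : ℕ => (n : ℝ) ^ ((2 - 2 * α) / (1 + 2 * α)) * Real.log n)
            =o[atTop] (fun n => τ n ^ 4)) ∧
        ((fun n : ℕ => (n : ℝ) ^ ((2 - 2 * α) / (1 + 2 * α)) * Real.log n)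
            =o[atTop] (fun n => τ n ^ 4) →
          BernsteinVonMises f x q k σ τ ∧
          ConvergenceRate f x q k σ τ
            (fun n => (n : ℝ) ^ ((1 - 2 * α) / (2 * (1 + 2 * α)))))) := by
  have hk1 : ∀ᶠ n in atTop, 1 ≤ k n := hk.mono fun n hn => hq.trans hn
  have hd : ∀ᶠ n : ℕ in atTop, ∀ θ : EuclideanSpace ℝ (Fin (k n)),
      C₁ * ((n : ℝ) / k n) * ‖θ‖ ^ 2 ≤
        θ.ofLp ⬝ᵥ (((designMatrix q (k n) (x n))ᵀ * designMatrix q (k n) (x n)) *ᵥ θ.ofLp) :=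
    hdesign.mono fun n hn θ => (hn θ).1
  have part1 : (fun n : ℕ => (k n : ℝ) ^ 2 * Real.log n / n) =o[atTop] (fun n => τ n ^ 2) →
      (fun n : ℕ => (k n : ℝ) ^ 3 * Real.log n / n) =o[atTop] (fun n => τ n ^ 4) →
        BernsteinVonMises f x q k σ τ ∧
        ConvergenceRate f x q k σ τ (fun n => (k n : ℝ) / Real.sqrt n) := fun h2 h4 =>
    have h := bernsteinVonMises_of_isLittleO hf hk1 hσ hC₁ hd h2 h4
    ⟨h, convergenceRate_of_bernsteinVonMises hk1 hσ hC₁ hd h⟩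
  refine ⟨part1, fun α hα hkα => ⟨conditions_iff_of_isTheta hα hkα τ, fun h => ?_⟩⟩
  obtain ⟨h2, h4⟩ := (conditions_iff_of_isTheta hα hkα τ).2 h
  obtain ⟨hb, hr⟩ := part1 h2 h4
  refine ⟨hb, ?_⟩
  obtain ⟨c, hc, hbound⟩ := (rate_isTheta hα hkα).1.exists_pos
  refine convergenceRate_mono hr (inv_pos.2 hc) ?_
  filter_upwards [hbound.bound] with n hn
  rw [Real.norm_of_nonneg (by positivity), Real.norm_of_nonneg (by positivity)] at hn
  rwa [inv_mul_le_iff₀ hc]
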